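/- **Setting.** Let $\mathcal P=\{(s_i,p_i)\}_{1\le i\le n}$ be stochastic points in $\mathbb R^D$ ($D\ge 1$) in the existential model: $s_i$ is present independently with probability $p_i\in[0,1]$, so a realization $P$ occurs with probability $\prod_{s_i\in P}p_i\prod_{s_i\notin P}(1-p_i)$. (For the stochastic minimum $j$-flat-center problem, these are the points after a linearization $\mathrm d(s,F)^2=\langle u,s'\rangle$ of dimension $D=O(j^2d^3)$.) The maximum over an empty set is $0$. For $A\subseteq\mathbb R^D$ let $\Pr[\mathcal P\cap A]=\sum_{s_i\in A}p_i$ be its total probability, and let $\mathcal P^\star=\{u\in\mathbb R^D:\langle u,s_i\rangle\ge 0\ \forall i\}$ be the polar set. Let $0<\varepsilon\le 1/2$, assume $\sum_i p_i\ge\varepsilon$, and let $\varepsilon'=\varepsilon^{O(D)}$ be a sufficiently small threshold. * For a unit vector $u$ let $t_u=\max\{t:\Pr[\mathcal P\cap\{x:\langle u,x\rangle\ge t\}]\ge\varepsilon'\}$, $H_u=\{x:\langle u,x\rangle\le t_u\}$, and $\mathcal H=\bigcap_{\|u\|=1}H_u$. * Let $\mathcal K$ be any intersection of $m=O(\varepsilon^{-O(D)})$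 closed halfspaces with $(1-\varepsilon)\mathcal K\subseteq\mathcal H\subseteq\mathcal K$, where $(1-\varepsilon)\mathcal K$ denotes the image of $\mathcal K$ under the homothety of ratio $1-\varepsilon$ about some point. Let $\mathcal P(\mathcal K)$ and $\mathcal P(\overline{\mathcal K})$ be the points inside and outside $\mathcal K$. * Draw $N$ independent realizations $S_1,\dots,S_N$ of $\mathcal P(\mathcal K)$. For each $k$ let $\mathcal E_k$ be any finite $\varepsilon$-kernel of $S_k$: $(1-\varepsilon)\,CH(S_k)\subseteq CH(\mathcal E_k)\subseteq CH(S_k)$, where $CH$ is the convex hull and the scaling is a homothety of ratio $1-\varepsilon$ about some point. **Lemma.** For every $a>0$ there is $A>0$ such that for every dimension $D\ge1$ and every $b>0$ there is $c>0$ such that for every $A_1>0$ there is $C>0$ with the following property. For all $n$, all $\mathcal P$ and $\varepsilon$ as above, all $\varepsilon'$ with $\varepsilon^{A_1D}\le\varepsilon'\le c\,\varepsilon^{AD}$, all $\mathcal K$ as above with $m\le b\,\varepsilon^{-aD}$, all $\delta\in(0,1)$ and all $$N\ \ge\ C\,(\varepsilon'\varepsilon)^{-2}\Bigl(\varepsilon^{-AD}\log\tfrac1\varepsilon+\log\tfrac1\delta\Bigr),$$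 the following holds with probability at least $1-\delta$ over $S_1,\dots,S_N$: for every choice of the $\varepsilon$-kernels $\mathcal E_k$ of $S_k$ and, simultaneously, for every direction $u\in\mathcal P^\star$, $$\frac1N\sum_{k=1}^N\max_{x\in\mathcal E_k}\langle u,x\rangle^{1/2}+\sum_{s_i\in\mathcal P(\overline{\mathcal K})}p_i\,\langle u,s_i\rangle^{1/2}\ \in\ \bigl[(1-4\varepsilon)X_u,\ (1+4\varepsilon)X_u\bigr],\qquad X_u=\mathbb E_{P\sim\mathcal P}\Bigl[\max_{x\in P}\langle u,x\rangle^{1/2}\Bigr].$$ -/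

import Mathlib

noncomputable section

/-- A stochastic point set in `ℝ^D` in the existential uncertainty model: the point `pt i` is
present, independently of the others, with probability `prob i`. -/
structure StochasticPoints (n D : ℕ) where
  pt : Fin n → EuclideanSpace ℝ (Fin D)
  prob : Fin n → ℝ
  prob_nonneg : ∀ i, 0 ≤ prob i
  prob_le_one : ∀ i, prob i ≤ 1

/-- `max_{x ∈ X} ⟨u, x⟩^{1/2}`, with the value `0` for the empty point set. -/
def maxSqrtInner {D : ℕ} (u : EuclideanSpace ℝ (Fin D))
    (X : Finset (EuclideanSpace ℝ (Fin D))) : ℝ :=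
  if h : X.Nonempty then X.sup' h (fun x => √(inner ℝ u x)) else 0

/-- `T` is a deterministic `ε`-kernel of `S`: `(1 - ε) CH(S) ⊆ CH(T) ⊆ CH(S)`, where the scaling
by `1 - ε` is a homothety about some centre `c`. -/
def IsEpsKernel {D : ℕ} (ε : ℝ) (S T : Set (EuclideanSpace ℝ (Fin D))) : Prop :=
  (∃ c : EuclideanSpace ℝ (Fin D),
    AffineMap.homothety c (1 - ε) '' convexHull ℝ S ⊆ convexHull ℝ T) ∧
  convexHull ℝ T ⊆ convexHull ℝ S

/-- `K` is the intersection of `m` closed halfspaces. -/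
def IsInterHalfspaces {D : ℕ} (m : ℕ) (K : Set (EuclideanSpace ℝ (Fin D))) : Prop :=
  ∃ (v : Fin m → EuclideanSpace ℝ (Fin D)) (r : Fin m → ℝ),
    (∀ k, v k ≠ 0) ∧ K = {x | ∀ k, inner ℝ (v k) x ≤ r k}

namespace StochasticPoints

variable {n D : ℕ}

/-- The point set that corresponds to a set `P` of indices. -/
def points (Q : StochasticPoints n D) (P : Finset (Fin n)) :
    Finset (EuclideanSpace ℝ (Fin D)) :=
  open Classical in P.image Q.pt

/-- The total probability `B = ∑ i, p_i`. -/
def totalProb (Q : StochasticPoints n D) : ℝ := ∑ i, Q.prob i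

/-- The total probability of the points that lie in `A`. -/
def massIn (Q : StochasticPoints n D) (A : Set (EuclideanSpace ℝ (Fin D))) : ℝ :=
  open Classical in ∑ i with Q.pt i ∈ A, Q.prob i

/-- The (indices of the) points inside `K`. -/
def inside (Q : StochasticPoints n D) (K : Set (EuclideanSpace ℝ (Fin D))) : Finset (Fin n) :=
  open Classical in {i | Q.pt i ∈ K}

/-- The (indices of the) points outside `K`. -/
def outside (Q : StochasticPoints n D) (K : Set (EuclideanSpace ℝ (Fin D))) : Finset (Fin n) :=
  open Classical in {i | Q.pt i ∉ K}

/-- The probability of the realization `P ⊆ I` of the stochastic points restricted to `I`. -/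
def realizationProb (Q : StochasticPoints n D) (I P : Finset (Fin n)) : ℝ :=
  (∏ i ∈ P, Q.prob i) * ∏ i ∈ I \ P, (1 - Q.prob i)

/-- `E_{P ∼ Q} [max_{x ∈ P} ⟨u, x⟩^{1/2}]`. -/
def expectedMax (Q : StochasticPoints n D) (u : EuclideanSpace ℝ (Fin D)) : ℝ :=
  ∑ P : Finset (Fin n), Q.realizationProb Finset.univ P * maxSqrtInner u (Q.points P)

/-- The probability that a tuple of `N` independent realizations of the stochastic points
restricted to `I` satisfies `event`. -/
def sampleProb (Q : StochasticPoints n D) (I : Finset (Fin n)) (N : ℕ)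
    (event : (Fin N → Finset (Fin n)) → Prop) : ℝ :=
  open Classical in
  ∑ S ∈ Fintype.piFinset (fun _ : Fin N => I.powerset) with event S,
    ∏ k, Q.realizationProb I (S k)

/-- The polar set of the points. -/
def polar (Q : StochasticPoints n D) : Set (EuclideanSpace ℝ (Fin D)) :=
  {u | ∀ i, 0 ≤ inner ℝ u (Q.pt i)}

/-- The position at which a hyperplane orthogonal to `u`, which sweeps through the points from
the far side `⟨u, x⟩ = +∞`, stops: the largest `t` such that the points with `⟨u, x⟩ ≥ t` have
total probability at least `ε'`. -/
def sweepLevel (Q : StochasticPoints n D) (ε' : ℝ) (u : EuclideanSpace ℝ (Fin D)) : ℝ :=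
  sSup {t : ℝ | ε' ≤ Q.massIn {x | t ≤ inner ℝ u x}}

/-- The convex set `ℋ = ⋂_u H_u` over all directions `u`, where `H_u` is the halfspace of the
points that lie behind the stopped sweep hyperplane. -/
def sweepHull (Q : StochasticPoints n D) (ε' : ℝ) : Set (EuclideanSpace ℝ (Fin D)) :=
  {x | ∀ u : EuclideanSpace ℝ (Fin D), ‖u‖ = 1 → inner ℝ u x ≤ Q.sweepLevel ε' u}

/-- `(1 - ε) 𝒦 ⊆ ℋ ⊆ 𝒦`, where the scaling by `1 - ε` is a homothety about some centre `c`
(if `ℋ` is not empty, then such a `c` necessarily lies in `ℋ`). -/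
def IsOuterApprox (Q : StochasticPoints n D) (ε ε' : ℝ)
    (K : Set (EuclideanSpace ℝ (Fin D))) : Prop :=
  (∃ c : EuclideanSpace ℝ (Fin D), AffineMap.homothety c (1 - ε) '' K ⊆ Q.sweepHull ε') ∧
  Q.sweepHull ε' ⊆ K

/-- The estimate `(1/N) ∑_k max_{x ∈ E_k} ⟨u, x⟩^{1/2} + ∑_{s_i ∉ K} p_i ⟨u, s_i⟩^{1/2}`. -/
def estimate (Q : StochasticPoints n D) (K : Set (EuclideanSpace ℝ (Fin D))) {N : ℕ}
    (E : Fin N → Finset (EuclideanSpace ℝ (Fin D))) (u : EuclideanSpace ℝ (Fin D)) : ℝ :=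
  (1 / (N : ℝ)) * ∑ k, maxSqrtInner u (E k) +
    ∑ i ∈ Q.outside K, Q.prob i * √(inner ℝ u (Q.pt i))

end StochasticPoints

end

/-! Inside and outside contributions are treated separately, and the kernels are handled
deterministically: on a set where `u` is nonnegative, passing to an `ε`-kernel lowers the maximum by
a factor of at least `1 - ε` (`IsEpsKernel.maxSqrtInner_mem_Icc`). Only the empirical mean of the
sample maxima is random.

Outside `K` the total probability is at most `ε / 2`. By Helly, each of the `m` halfspaces cuts off
at most `D + 1` open sweep halfspaces' worth of mass, hence at most `(D + 1) ε'`
(`massIn_halfspace_le`). Rare points almost never occur together, so the expected maximum is the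
inside expectation plus the sum of `p_i ⟨u, s_i⟩^{1/2}` over the outside, up to a factor `1 ± ε`
(`expectOn_union_le`, `le_expectOn_union`).

Inside `K` the values `⟨u, x⟩` are at most `2t`, where a halfspace `⟨u, x⟩ ≥ t` has mass at least
`ε'` (`IsOuterApprox.exists_level`). Hence `X_u ≥ (ε' / 2) √t` (`le_expectedMax`), and a deviation
of order `ε' ε √t` is a relative error `ε`. This accuracy holds for all `u` at once
(`le_sampleProb_uniform`): after scaling, functionals with values in `[0, 1]` on the inside points
have a net of size polynomial in `1 / (ε' ε)` for fixed `D`, however many points there are, and a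
Chernoff bound with a union bound over the net suffices. -/

/-! ### Nets of linear functionals on finite point sets -/

/-- **Barycentric spanners**: a finite set `V` contains at most `finrank` many vectors such that
every element of `V` is a combination of them with coefficients in `[-1, 1]`. -/
theorem exists_barycentricSpanner {E : Type*} [AddCommGroup E] [Module ℝ E]
    [FiniteDimensional ℝ E] {V : Set E} (hV : V.Finite) :
    ∃ (d : ℕ) (v : Fin d → E), d ≤ Module.finrank ℝ E ∧ (∀ j, v j ∈ V) ∧
      ∀ x ∈ V, ∃ c : Fin d → ℝ, (∀ j, |c j| ≤ 1) ∧ x = ∑ j, c j • v j := by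
  have := hV.to_subtype
  set W := Submodule.span ℝ V
  set d := Module.finrank ℝ W
  let b : Module.Basis (Fin d) ℝ W := Module.finBasis ℝ W
  let f : V → W := fun x => ⟨x, Submodule.subset_span x.2⟩
  obtain ⟨g, hgV, hgspan, hgli⟩ := Submodule.exists_fun_fin_finrank_span_eq ℝ V
  let σ₀ : Fin d → V := fun j => ⟨g j, hgV j⟩
  have hσ₀ : b.det (f ∘ σ₀) ≠ 0 := by
    have hli : LinearIndependent ℝ (f ∘ σ₀) := LinearIndependent.of_comp W.subtype hgli
    have := (Module.Basis.is_basis_iff_det b (v := f ∘ σ₀)).1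
      ⟨hli, hli.span_eq_top_of_card_eq_finrank' (by simp [d])⟩
    exact this.ne_zero
  have : Nonempty (Fin d → V) := ⟨σ₀⟩
  -- Choose the basis from `V` of maximal `|det|`. By Cramer's rule a coordinate of `x` is the ratio
  -- of the determinant with one vector replaced by `x` to the maximal one, so it lies in `[-1, 1]`.
  obtain ⟨σ, hσ⟩ := Finite.exists_max fun σ : Fin d → V => |b.det (f ∘ σ)|
  have hpos : 0 < |b.det (f ∘ σ)| := (abs_pos.2 hσ₀).trans_le (hσ σ₀)
  have hne : b.det (f ∘ σ) ≠ 0 := abs_pos.1 hpos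
  obtain ⟨hli, hsp⟩ := (Module.Basis.is_basis_iff_det b).2 (isUnit_iff_ne_zero.2 hne)
  refine ⟨d, fun j => σ j, Submodule.finrank_le W, fun j => (σ j).2, fun x hx => ?_⟩
  refine ⟨fun j => (Module.Basis.mk hli hsp.ge).coord j (f ⟨x, hx⟩), fun j => ?_, ?_⟩
  · have h := LinearMap.congr_fun (b.det_smul_mk_coord_eq_det_update hli hsp.ge j) (f ⟨x, hx⟩)
    have h2 : b.det (f ∘ σ) * (Module.Basis.mk hli hsp.ge).coord j (f ⟨x, hx⟩) =
        b.det (f ∘ Function.update σ j ⟨x, hx⟩) := by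
      rw [Function.comp_update]
      exact h
    have h3 := hσ (Function.update σ j ⟨x, hx⟩)
    simp only [← h2, abs_mul] at h3
    exact le_of_mul_le_mul_left (by simpa using h3) hpos
  · have h := (Module.Basis.mk hli hsp.ge).sum_repr (f ⟨x, hx⟩)
    have h2 := congrArg W.subtype h
    simp only [map_sum, map_smul, Module.Basis.mk_apply] at h2
    exact h2.symm

/-- The linear functionals with values in `[0, 1]` on finitely many points of `ℝ^D` have a net of
size `(q + 1)^D` with respect to the uniform distance `D / q` on these points. -/
theorem exists_finset_functional_net {D : ℕ} {V : Set (EuclideanSpace ℝ (Fin D))} (hV : V.Finite)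
    {q : ℕ} (hq : 0 < q) :
    ∃ R : Finset (EuclideanSpace ℝ (Fin D)), R.card ≤ (q + 1) ^ D ∧
      (∀ u ∈ R, ∀ x ∈ V, inner ℝ u x ∈ Set.Icc (0 : ℝ) 1) ∧
      ∀ u : EuclideanSpace ℝ (Fin D), (∀ x ∈ V, inner ℝ u x ∈ Set.Icc (0 : ℝ) 1) →
        ∃ u' ∈ R, ∀ x ∈ V, |inner ℝ u x - inner ℝ u' x| ≤ D / q := by
  classical
  obtain ⟨d, v, hd, hvV, hv⟩ := exists_barycentricSpanner hV
  rw [finrank_euclideanSpace_fin] at hd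
  have hq' : (0 : ℝ) < q := by exact_mod_cast hq
  set U : Set (EuclideanSpace ℝ (Fin D)) := {u | ∀ x ∈ V, inner ℝ u x ∈ Set.Icc (0 : ℝ) 1}
  -- Round the values at the spanner down to multiples of `1 / q`; the value `1` needs the extra
  -- cell. The net takes one functional of `U` from each occupied cell, so its members again have
  -- values in `[0, 1]`.
  let key : U → (Fin d → Fin (q + 1)) := fun u j =>
    ⟨⌊inner ℝ u.1 (v j) * (q : ℝ)⌋₊, Nat.lt_succ_of_le (Nat.floor_le_of_le (by
      have := (u.2 _ (hvV j)).2
      nlinarith))⟩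
  let T : Finset (Fin d → Fin (q + 1)) := {k | k ∈ Set.range key}
  have hT : ∀ k ∈ T, ∃ u, key u = k := by simp [T]
  rcases isEmpty_or_nonempty U with hU | hU
  · exact ⟨∅, by simp, by simp, fun u hu => (hU.false ⟨u, hu⟩).elim⟩
  choose! r hr using hT
  refine ⟨T.image (fun k => (r k).1), ?_, ?_, ?_⟩
  · refine Finset.card_image_le.trans ((Finset.card_le_univ _).trans ?_)
    simpa using Nat.pow_le_pow_right (by lia) hd
  · intro u hu
    obtain ⟨k, -, rfl⟩ := Finset.mem_image.1 hu
    exact (r k).2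
  · intro u hu
    have hk : key ⟨u, hu⟩ ∈ T := Finset.mem_filter.2 ⟨Finset.mem_univ _, _, rfl⟩
    refine ⟨_, Finset.mem_image_of_mem _ hk, fun x hx => ?_⟩
    have hkey := hr _ hk
    set u' := r (key ⟨u, hu⟩)
    have hj : ∀ j, |inner ℝ u (v j) - inner ℝ u'.1 (v j)| ≤ 1 / q := fun j => by
      have h1 : ⌊inner ℝ u'.1 (v j) * (q : ℝ)⌋₊ = ⌊inner ℝ u (v j) * (q : ℝ)⌋₊ :=
        congrArg Fin.val (congrFun hkey j)
      have p1 := mul_nonneg (hu _ (hvV j)).1 hq'.le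
      have p2 := mul_nonneg (u'.2 _ (hvV j)).1 hq'.le
      have a1 := Nat.floor_le p1
      have a2 := Nat.floor_le p2
      have b1 := Nat.lt_floor_add_one (inner ℝ u (v j) * (q : ℝ))
      have b2 := Nat.lt_floor_add_one (inner ℝ u'.1 (v j) * (q : ℝ))
      rw [h1] at a2 b2
      rw [le_div_iff₀ hq', ← abs_of_pos hq', ← abs_mul, sub_mul, abs_le]
      constructor <;> linarith
    obtain ⟨c, hc, rfl⟩ := hv x hx
    simp only [inner_sum, inner_smul_right, ← Finset.sum_sub_distrib, ← mul_sub]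
    calc |∑ j, c j * (inner ℝ u (v j) - inner ℝ u'.1 (v j))|
        ≤ ∑ j, |c j * (inner ℝ u (v j) - inner ℝ u'.1 (v j))| := Finset.abs_sum_le_sum_abs _ _
      _ ≤ ∑ _j : Fin d, (1 / q : ℝ) := Finset.sum_le_sum fun j _ => by
          rw [abs_mul]
          exact (mul_le_of_le_one_left (abs_nonneg _) (hc j)).trans (hj j)
      _ = d / q := by simp [div_eq_mul_inv]
      _ ≤ D / q := by gcongr

/-! ### Concentration of independent samples -/

/-- A Chernoff bound for `N` independent samples from a finitely supported weight function. -/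
theorem sum_piFinset_prod_le_exp {α : Type*} [DecidableEq α] (s : Finset α) (w h : α → ℝ)
    (hw : ∀ x ∈ s, 0 ≤ w x) (hw1 : ∑ x ∈ s, w x = 1) (hh : ∀ x ∈ s, |h x| ≤ 1)
    (hmean : ∑ x ∈ s, w x * h x = 0) {τ : ℝ} (hτ : 0 ≤ τ) (hτ1 : τ ≤ 1) (N : ℕ)
    (F : Finset (Fin N → α)) (hF : F ⊆ Fintype.piFinset fun _ => s)
    (hFτ : ∀ S ∈ F, τ * N ≤ ∑ k, h (S k)) :
    ∑ S ∈ F, ∏ k, w (S k) ≤ Real.exp (-(τ ^ 2 * N / 4)) := by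
  have hS : ∀ S ∈ Fintype.piFinset (fun _ : Fin N => s), 0 ≤ ∏ k, w (S k) := fun S hS =>
    Finset.prod_nonneg fun k _ => hw _ (Fintype.mem_piFinset.1 hS k)
  -- The tilt `τ / 2` and `exp y ≤ 1 + y + y ^ 2` for `|y| ≤ 1` give the exponent `τ ^ 2 / 4 - τ ^ 2
  -- / 2` per sample.
  have hmgf : ∑ x ∈ s, w x * Real.exp (τ / 2 * h x) ≤ Real.exp ((τ / 2) ^ 2) := by
    calc ∑ x ∈ s, w x * Real.exp (τ / 2 * h x)
        ≤ ∑ x ∈ s, w x * (1 + τ / 2 * h x + (τ / 2) ^ 2) := by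
          refine Finset.sum_le_sum fun x hx => mul_le_mul_of_nonneg_left ?_ (hw x hx)
          have h1 : |τ / 2 * h x| ≤ τ / 2 := by
            rw [abs_mul, abs_of_nonneg (by positivity : 0 ≤ τ / 2)]
            exact mul_le_of_le_one_right (by positivity) (hh x hx)
          have h2 := (abs_le.1 (Real.abs_exp_sub_one_sub_id_le (h1.trans (by linarith)))).2
          have h3 : (τ / 2 * h x) ^ 2 ≤ (τ / 2) ^ 2 := by
            rw [← sq_abs]
            gcongr
          linarith
      _ = 1 + (τ / 2) ^ 2 := by
          have : ∀ x, w x * (1 + τ / 2 * h x + (τ / 2) ^ 2) =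
              (1 + (τ / 2) ^ 2) * w x + τ / 2 * (w x * h x) := fun x => by ring
          simp only [this, Finset.sum_add_distrib, ← Finset.mul_sum, hw1, hmean]
          ring
      _ ≤ _ := by linarith [Real.add_one_le_exp ((τ / 2) ^ 2)]
  calc ∑ S ∈ F, ∏ k, w (S k)
      ≤ ∑ S ∈ F, Real.exp (-(τ / 2 * (τ * N))) * ∏ k, w (S k) * Real.exp (τ / 2 * h (S k)) := by
        refine Finset.sum_le_sum fun S hSF => ?_
        rw [Finset.prod_mul_distrib, ← Real.exp_sum, ← Finset.mul_sum, mul_left_comm,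
          ← Real.exp_add]
        refine le_mul_of_one_le_right (hS S (hF hSF)) (Real.one_le_exp ?_)
        nlinarith [hFτ S hSF]
    _ ≤ ∑ S ∈ Fintype.piFinset (fun _ : Fin N => s),
          Real.exp (-(τ / 2 * (τ * N))) * ∏ k, w (S k) * Real.exp (τ / 2 * h (S k)) := by
        refine Finset.sum_le_sum_of_subset_of_nonneg hF fun S hS _ => ?_
        exact mul_nonneg (Real.exp_nonneg _) (Finset.prod_nonneg fun k _ =>
          mul_nonneg (hw _ (Fintype.mem_piFinset.1 hS k)) (Real.exp_nonneg _))
    _ = Real.exp (-(τ / 2 * (τ * N))) * (∑ x ∈ s, w x * Real.exp (τ / 2 * h x)) ^ N := by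
        rw [← Finset.mul_sum, Finset.sum_prod_piFinset s
          (fun (_ : Fin N) x => w x * Real.exp (τ / 2 * h x))]
        simp
    _ ≤ Real.exp (-(τ / 2 * (τ * N))) * Real.exp ((τ / 2) ^ 2) ^ N := by
        gcongr
        exact Finset.sum_nonneg fun x hx => mul_nonneg (hw x hx) (Real.exp_nonneg _)
    _ = _ := by
        rw [← Real.exp_nat_mul, ← Real.exp_add]
        ring_nf

/-! ### The functional `maxSqrtInner` and its behaviour on kernels -/

section maxSqrtInner

variable {D : ℕ} {u : EuclideanSpace ℝ (Fin D)} {X : Finset (EuclideanSpace ℝ (Fin D))}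

theorem sqrt_inner_le_maxSqrtInner {x : EuclideanSpace ℝ (Fin D)} (hx : x ∈ X) :
    √(inner ℝ u x) ≤ maxSqrtInner u X := by
  rw [maxSqrtInner, dif_pos ⟨x, hx⟩]
  exact Finset.le_sup' (fun x => √(inner ℝ u x)) hx

theorem maxSqrtInner_le {r : ℝ} (hr : 0 ≤ r) (h : ∀ x ∈ X, √(inner ℝ u x) ≤ r) :
    maxSqrtInner u X ≤ r := by
  rw [maxSqrtInner]
  split_ifs with hX
  · exact Finset.sup'_le _ _ h
  · exact hr

theorem maxSqrtInner_nonneg : 0 ≤ maxSqrtInner u X := by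
  rcases X.eq_empty_or_nonempty with rfl | ⟨x, hx⟩
  · simp [maxSqrtInner]
  · exact (Real.sqrt_nonneg _).trans (sqrt_inner_le_maxSqrtInner hx)

theorem maxSqrtInner_mono {Y : Finset (EuclideanSpace ℝ (Fin D))} (h : X ⊆ Y) :
    maxSqrtInner u X ≤ maxSqrtInner u Y :=
  maxSqrtInner_le maxSqrtInner_nonneg fun _ hx => sqrt_inner_le_maxSqrtInner (h hx)

theorem maxSqrtInner_smul {c : ℝ} (hc : 0 ≤ c) :
    maxSqrtInner (c • u) X = √c * maxSqrtInner u X := by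
  have key : ∀ x, √(inner ℝ (c • u) x) = √c * √(inner ℝ u x) := fun x => by
    rw [real_inner_smul_left, Real.sqrt_mul hc]
  apply le_antisymm
  · refine maxSqrtInner_le (mul_nonneg (Real.sqrt_nonneg _) maxSqrtInner_nonneg) fun x hx => ?_
    rw [key]
    gcongr
    exact sqrt_inner_le_maxSqrtInner hx
  · rcases X.eq_empty_or_nonempty with rfl | hX
    · simp [maxSqrtInner]
    · obtain ⟨x, hx, h⟩ := X.exists_mem_eq_sup' hX (fun x => √(inner ℝ u x))
      have : maxSqrtInner u X = √(inner ℝ u x) := by rw [maxSqrtInner, dif_pos hX, h]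
      rw [this, ← key]
      exact sqrt_inner_le_maxSqrtInner hx

/-- Follows from `√(z + η ^ 2) ≤ √z + η`. An error `η` after the square root therefore needs a net
of accuracy `η ^ 2`. -/
theorem maxSqrtInner_le_add {u' : EuclideanSpace ℝ (Fin D)} {η : ℝ} (hη : 0 ≤ η)
    (h : ∀ x ∈ X, inner ℝ u x ≤ inner ℝ u' x + η ^ 2) :
    maxSqrtInner u X ≤ maxSqrtInner u' X + η := by
  refine maxSqrtInner_le (add_nonneg maxSqrtInner_nonneg hη) fun x hx => ?_
  have h1 : √(inner ℝ u x) ≤ √(inner ℝ u' x) + η := by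
    rw [Real.sqrt_le_left (by positivity)]
    rcases le_total 0 (inner ℝ u' x) with h0 | h0
    · nlinarith [h x hx, Real.sq_sqrt h0, Real.sqrt_nonneg (inner ℝ u' x)]
    · nlinarith [h x hx, Real.sqrt_nonneg (inner ℝ u' x)]
  exact h1.trans (add_le_add_left (sqrt_inner_le_maxSqrtInner hx) _)

/-- An `ε`-kernel preserves the maximum of a linear functional that is nonnegative on the set. -/
theorem IsEpsKernel.maxSqrtInner_mem_Icc {ε : ℝ} (hε : 0 < ε) (hε1 : ε ≤ 1)
    {T : Finset (EuclideanSpace ℝ (Fin D))}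
    (h : IsEpsKernel ε (X : Set (EuclideanSpace ℝ (Fin D))) T)
    (hu : ∀ x ∈ X, 0 ≤ inner ℝ u x) :
    maxSqrtInner u T ∈ Set.Icc ((1 - ε) * maxSqrtInner u X) (maxSqrtInner u X) := by
  obtain ⟨⟨c, hc⟩, hTX⟩ := h
  rcases X.eq_empty_or_nonempty with rfl | hX
  · have : T = ∅ := by simpa [Set.subset_empty_iff] using hTX
    subst this
    simp [maxSqrtInner]
  have conv : ∀ {Y : Finset (EuclideanSpace ℝ (Fin D))} {r : ℝ},
      (∀ x ∈ Y, inner ℝ u x ≤ r) → ∀ x ∈ convexHull ℝ (Y : Set _), inner ℝ u x ≤ r :=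
    fun {Y r} hY x hx => convexHull_min (t := {x | inner ℝ u x ≤ r}) hY
      (convex_halfSpace_le (innerₛₗ ℝ u).isLinear r) hx
  have conv' : ∀ {Y : Finset (EuclideanSpace ℝ (Fin D))} {r : ℝ},
      (∀ x ∈ Y, r ≤ inner ℝ u x) → ∀ x ∈ convexHull ℝ (Y : Set _), r ≤ inner ℝ u x :=
    fun {Y r} hY x hx => convexHull_min (t := {x | r ≤ inner ℝ u x}) hY
      (convex_halfSpace_ge (innerₛₗ ℝ u).isLinear r) hx
  have hom : ∀ x ∈ X, (1 - ε) * inner ℝ u x + ε * inner ℝ u c = inner ℝ u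
      (AffineMap.homothety c (1 - ε) x) := fun x _ => by
    simp only [AffineMap.homothety_apply, vsub_eq_sub, vadd_eq_add, inner_add_right,
      real_inner_smul_right, inner_sub_right]
    ring
  have homT : ∀ x ∈ X, AffineMap.homothety c (1 - ε) x ∈ convexHull ℝ (T : Set _) := fun x hx =>
    hc (Set.mem_image_of_mem _ (subset_convexHull ℝ _ hx))
  -- The homothety sends a minimizer `y` of `u` on `X` into `CH(X)`, so it cannot decrease `⟨u, y⟩`;
  -- hence `⟨u, c⟩ ≥ ⟨u, y⟩ ≥ 0`.
  have hc0 : 0 ≤ inner ℝ u c := by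
    obtain ⟨y, hy, hmin⟩ := X.exists_min_image (fun x => inner ℝ u x) hX
    have h1 := conv' hmin _ (hTX (homT y hy))
    rw [← hom y hy] at h1
    have : ε * inner ℝ u y ≤ ε * inner ℝ u c := by linarith
    exact (hu y hy).trans (le_of_mul_le_mul_left this hε)
  have sq : ∀ {z M : ℝ}, 0 ≤ M → √z ≤ M → z ≤ M ^ 2 := fun hM hz => (Real.sqrt_le_left hM).1 hz
  constructor
  · have hpos : 0 ≤ 1 - ε := by linarith
    suffices ∀ x ∈ X, √(inner ℝ u x) * (1 - ε) ≤ maxSqrtInner u T by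
      obtain ⟨x, hx, hmax⟩ := X.exists_mem_eq_sup' hX (fun x => √(inner ℝ u x))
      have hm : maxSqrtInner u X = √(inner ℝ u x) := by rw [maxSqrtInner, dif_pos hX, hmax]
      rw [hm, mul_comm]
      exact this x hx
    intro x hx
    have h1 := conv (r := maxSqrtInner u T ^ 2)
      (fun y hy => sq maxSqrtInner_nonneg (sqrt_inner_le_maxSqrtInner hy)) _ (homT x hx)
    rw [← hom x hx] at h1
    -- After squaring, the claim follows from `(1 - ε) ^ 2 ≤ 1 - ε` and `⟨u, c⟩ ≥ 0`.
    refine le_of_sq_le_sq ?_ maxSqrtInner_nonneg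
    rw [mul_pow, Real.sq_sqrt (hu x hx)]
    nlinarith [hu x hx, mul_nonneg hε.le hc0, mul_nonneg (mul_nonneg hpos hε.le) (hu x hx)]
  · refine maxSqrtInner_le maxSqrtInner_nonneg fun x hx => ?_
    rw [Real.sqrt_le_left maxSqrtInner_nonneg]
    exact conv (fun y hy => sq maxSqrtInner_nonneg (sqrt_inner_le_maxSqrtInner hy)) _
      (hTX (subset_convexHull ℝ _ hx))

end maxSqrtInner

/-! ### Expectations over realizations -/

namespace StochasticPoints

variable {n D : ℕ}

theorem mem_points {Q : StochasticPoints n D} {P : Finset (Fin n)}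
    {x : EuclideanSpace ℝ (Fin D)} : x ∈ Q.points P ↔ ∃ i ∈ P, Q.pt i = x := by
  simp [points]

theorem realizationProb_nonneg (Q : StochasticPoints n D) (I P : Finset (Fin n)) :
    0 ≤ Q.realizationProb I P :=
  mul_nonneg (Finset.prod_nonneg fun i _ => Q.prob_nonneg i)
    (Finset.prod_nonneg fun i _ => sub_nonneg.2 (Q.prob_le_one i))

theorem sum_realizationProb (Q : StochasticPoints n D) (I : Finset (Fin n)) :
    ∑ P ∈ I.powerset, Q.realizationProb I P = 1 := by
  have := Finset.prod_add Q.prob (fun i => 1 - Q.prob i) I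
  simpa [realizationProb] using this.symm

/-- The expectation of `F` over the realizations of the stochastic points restricted to `I`. -/
def expectOn (Q : StochasticPoints n D) (I : Finset (Fin n)) (F : Finset (Fin n) → ℝ) : ℝ :=
  ∑ P ∈ I.powerset, Q.realizationProb I P * F P

theorem expectOn_mono (Q : StochasticPoints n D) {I : Finset (Fin n)}
    {F G : Finset (Fin n) → ℝ} (h : ∀ P ⊆ I, F P ≤ G P) : Q.expectOn I F ≤ Q.expectOn I G :=
  Finset.sum_le_sum fun P hP => mul_le_mul_of_nonneg_left (h P (Finset.mem_powerset.1 hP))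
    (Q.realizationProb_nonneg I P)

theorem expectOn_add_const (Q : StochasticPoints n D) (I : Finset (Fin n))
    (F : Finset (Fin n) → ℝ) (r : ℝ) :
    Q.expectOn I (fun P => F P + r) = Q.expectOn I F + r := by
  simp only [expectOn, mul_add, Finset.sum_add_distrib, ← Finset.sum_mul, sum_realizationProb,
    one_mul]

theorem expectOn_const_mul (Q : StochasticPoints n D) (I : Finset (Fin n))
    (F : Finset (Fin n) → ℝ) (r : ℝ) :
    Q.expectOn I (fun P => r * F P) = r * Q.expectOn I F := by
  simp only [expectOn, Finset.mul_sum, mul_left_comm]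

theorem expectOn_const (Q : StochasticPoints n D) (I : Finset (Fin n)) (r : ℝ) :
    Q.expectOn I (fun _ => r) = r := by
  simp only [expectOn, ← Finset.sum_mul, sum_realizationProb, one_mul]

/-- Conditioning on the presence of the point `i`; this drives the inductions below. -/
theorem expectOn_insert (Q : StochasticPoints n D) {I : Finset (Fin n)} {i : Fin n} (hi : i ∉ I)
    (F : Finset (Fin n) → ℝ) :
    Q.expectOn (insert i I) F =
      (1 - Q.prob i) * Q.expectOn I F + Q.prob i * Q.expectOn I (fun P => F (insert i P)) := by
  rw [expectOn, Finset.sum_powerset_insert hi, expectOn, expectOn, Finset.mul_sum, Finset.mul_sum]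
  congr 1 <;> refine Finset.sum_congr rfl fun P hP => ?_ <;>
    have hiP : i ∉ P := fun h => hi (Finset.mem_powerset.1 hP h)
  · rw [realizationProb, Finset.insert_sdiff_of_notMem _ hiP,
      Finset.prod_insert (by simp [hi]), realizationProb]
    ring
  · rw [realizationProb, Finset.insert_sdiff_insert, Finset.sdiff_insert_of_notMem hi,
      Finset.prod_insert hiP, realizationProb]
    ring

/-- `max_{s_i ∈ P} ⟨u, s_i⟩^{1/2}` for a realization `P`. -/
noncomputable def maxOn (Q : StochasticPoints n D) (u : EuclideanSpace ℝ (Fin D)) (P : Finset (Fin n)) : ℝ :=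
  maxSqrtInner u (Q.points P)

theorem maxOn_nonneg (Q : StochasticPoints n D) (u : EuclideanSpace ℝ (Fin D))
    (P : Finset (Fin n)) : 0 ≤ Q.maxOn u P :=
  maxSqrtInner_nonneg

theorem maxOn_mono (Q : StochasticPoints n D) (u : EuclideanSpace ℝ (Fin D))
    {P P' : Finset (Fin n)} (h : P ⊆ P') : Q.maxOn u P ≤ Q.maxOn u P' :=
  maxSqrtInner_mono (Finset.image_subset_image h)

theorem sqrt_le_maxOn (Q : StochasticPoints n D) (u : EuclideanSpace ℝ (Fin D))
    {P : Finset (Fin n)} {i : Fin n} (hi : i ∈ P) : √(inner ℝ u (Q.pt i)) ≤ Q.maxOn u P :=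
  sqrt_inner_le_maxSqrtInner (mem_points.2 ⟨i, hi, rfl⟩)

theorem maxOn_le {Q : StochasticPoints n D} {u : EuclideanSpace ℝ (Fin D)} {P : Finset (Fin n)}
    {r : ℝ} (hr : 0 ≤ r) (h : ∀ i ∈ P, √(inner ℝ u (Q.pt i)) ≤ r) : Q.maxOn u P ≤ r :=
  maxSqrtInner_le hr fun x hx => by
    obtain ⟨i, hi, rfl⟩ := mem_points.1 hx
    exact h i hi

theorem maxOn_insert_le (Q : StochasticPoints n D) (u : EuclideanSpace ℝ (Fin D))
    (P : Finset (Fin n)) (i : Fin n) :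
    Q.maxOn u (insert i P) ≤ Q.maxOn u P + √(inner ℝ u (Q.pt i)) := by
  refine maxOn_le (add_nonneg (Q.maxOn_nonneg u P) (Real.sqrt_nonneg _)) fun j hj => ?_
  rcases Finset.mem_insert.1 hj with rfl | hj
  · linarith [Q.maxOn_nonneg u P]
  · linarith [Q.sqrt_le_maxOn u hj, Real.sqrt_nonneg (inner ℝ u (Q.pt i))]

theorem expectOn_maxOn_nonneg (Q : StochasticPoints n D) (u : EuclideanSpace ℝ (Fin D))
    (I : Finset (Fin n)) : 0 ≤ Q.expectOn I (Q.maxOn u) :=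
  Finset.sum_nonneg fun P _ => mul_nonneg (Q.realizationProb_nonneg I P) (Q.maxOn_nonneg u P)

theorem expectedMax_eq (Q : StochasticPoints n D) (u : EuclideanSpace ℝ (Fin D)) :
    Q.expectedMax u = Q.expectOn Finset.univ (Q.maxOn u) := by
  simp only [expectedMax, expectOn, Finset.powerset_univ, maxOn]

/-- A present point of `J` raises the maximum by at most its own value, so its expected effect is at
most `p_i` times that value. -/
theorem expectOn_union_le (Q : StochasticPoints n D) (u : EuclideanSpace ℝ (Fin D))
    {I J : Finset (Fin n)} (hIJ : Disjoint I J) :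
    Q.expectOn (I ∪ J) (Q.maxOn u) ≤
      Q.expectOn I (Q.maxOn u) + ∑ i ∈ J, Q.prob i * √(inner ℝ u (Q.pt i)) := by
  induction J using Finset.induction_on with
  | empty => simp
  | insert i J hi ih =>
    rw [Finset.disjoint_insert_right] at hIJ
    rw [Finset.union_insert, expectOn_insert _ (by simp [hi, hIJ.1]), Finset.sum_insert hi]
    have h1 : Q.expectOn (I ∪ J) (fun P => Q.maxOn u (insert i P)) ≤
        Q.expectOn (I ∪ J) (Q.maxOn u) + √(inner ℝ u (Q.pt i)) := by
      rw [← expectOn_add_const]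
      exact Q.expectOn_mono fun P _ => Q.maxOn_insert_le u P i
    have h2 := mul_le_mul_of_nonneg_left h1 (Q.prob_nonneg i)
    linarith [ih hIJ.2]

/-- When a new point of `J` is present, the maximum is at least its value; when it is absent, the
induction hypothesis applies. The loss factor survives since `(1 - p)(1 - μ) ≥ 1 - p - μ`. -/
theorem le_expectOn_union (Q : StochasticPoints n D) (u : EuclideanSpace ℝ (Fin D))
    {I J : Finset (Fin n)} (hIJ : Disjoint I J) (hJ : ∑ i ∈ J, Q.prob i ≤ 1) :
    (1 - ∑ i ∈ J, Q.prob i) *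
        (Q.expectOn I (Q.maxOn u) + ∑ i ∈ J, Q.prob i * √(inner ℝ u (Q.pt i))) ≤
      Q.expectOn (I ∪ J) (Q.maxOn u) := by
  induction J using Finset.induction_on with
  | empty => simp
  | insert i J hi ih =>
    rw [Finset.disjoint_insert_right] at hIJ
    rw [Finset.sum_insert hi] at hJ
    rw [Finset.union_insert, expectOn_insert _ (by simp [hi, hIJ.1]), Finset.sum_insert hi,
      Finset.sum_insert hi]
    have hp := Q.prob_nonneg i
    have hp1 := Q.prob_le_one i
    have hμ : 0 ≤ ∑ i ∈ J, Q.prob i := Finset.sum_nonneg fun i _ => Q.prob_nonneg i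
    have hT : 0 ≤ ∑ i ∈ J, Q.prob i * √(inner ℝ u (Q.pt i)) :=
      Finset.sum_nonneg fun i _ => mul_nonneg (Q.prob_nonneg i) (Real.sqrt_nonneg _)
    have hY := Q.expectOn_maxOn_nonneg u I
    have h1 : √(inner ℝ u (Q.pt i)) ≤ Q.expectOn (I ∪ J) (fun P => Q.maxOn u (insert i P)) := by
      rw [← Q.expectOn_const (I ∪ J) √(inner ℝ u (Q.pt i))]
      exact Q.expectOn_mono fun P _ => Q.sqrt_le_maxOn u (Finset.mem_insert_self i P)
    have h2 := mul_le_mul_of_nonneg_left h1 hp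
    have h3 := mul_le_mul_of_nonneg_left (ih hIJ.2 (by linarith)) (sub_nonneg.2 hp1)
    have h4 : 0 ≤ Q.prob i * √(inner ℝ u (Q.pt i)) := mul_nonneg hp (Real.sqrt_nonneg _)
    generalize ∑ i ∈ J, Q.prob i = μ at *
    generalize ∑ i ∈ J, Q.prob i * √(inner ℝ u (Q.pt i)) = T at *
    generalize Q.expectOn I (Q.maxOn u) = Y at *
    nlinarith [mul_nonneg (mul_nonneg hp hμ) (add_nonneg hY hT), mul_nonneg (add_nonneg hp hμ) h4]

/-- A halfspace of total probability `ε'` forces a lower bound on the expected maximum. -/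
theorem le_expectedMax (Q : StochasticPoints n D) {ε' t : ℝ} (hε' : 0 ≤ ε') (hε'1 : ε' ≤ 1)
    {u : EuclideanSpace ℝ (Fin D)} (h : ε' ≤ Q.massIn {x | t ≤ inner ℝ u x}) :
    ε' / 2 * √t ≤ Q.expectedMax u := by
  classical
  set q : Fin n → ℝ := fun i => if Q.pt i ∈ {x | t ≤ inner ℝ u x} then Q.prob i else 0
  have hq : ∀ i, 0 ≤ q i ∧ q i ≤ 1 := fun i => by
    simp only [q]
    split_ifs
    exacts [⟨Q.prob_nonneg i, Q.prob_le_one i⟩, ⟨le_rfl, zero_le_one⟩]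
  -- The product is the probability that no point of `L` in the halfspace is present; otherwise the
  -- maximum is at least `√t`.
  have key : ∀ L : Finset (Fin n),
      (1 - ∏ i ∈ L, (1 - q i)) * √t ≤ Q.expectOn L (Q.maxOn u) := fun L => by
    induction L using Finset.induction_on with
    | empty => simpa using Q.expectOn_maxOn_nonneg u ∅
    | insert i L hi ih =>
      rw [expectOn_insert _ hi, Finset.prod_insert hi]
      have hp := Q.prob_nonneg i
      have hmono : Q.expectOn L (Q.maxOn u) ≤ Q.expectOn L (fun P => Q.maxOn u (insert i P)) :=
        Q.expectOn_mono fun P _ => Q.maxOn_mono u (Finset.subset_insert i P)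
      by_cases hit : t ≤ inner ℝ u (Q.pt i)
      · have hqi : q i = Q.prob i := if_pos hit
        have h1 : √t ≤ Q.expectOn L (fun P => Q.maxOn u (insert i P)) := by
          rw [← Q.expectOn_const L √t]
          exact Q.expectOn_mono fun P _ =>
            (Real.sqrt_le_sqrt hit).trans (Q.sqrt_le_maxOn u (Finset.mem_insert_self i P))
        rw [hqi]
        nlinarith [mul_le_mul_of_nonneg_left ih (sub_nonneg.2 (Q.prob_le_one i)),
          mul_le_mul_of_nonneg_left h1 hp]
      · have hqi : q i = 0 := if_neg hit
        rw [hqi]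
        nlinarith [mul_le_mul_of_nonneg_left hmono hp]
  have hmass : Q.massIn {x | t ≤ inner ℝ u x} = ∑ i, q i := by
    simp only [massIn, q, Finset.sum_filter]
  have hprod : ∏ i, (1 - q i) ≤ 1 - ε' / 2 := by
    calc ∏ i, (1 - q i) ≤ ∏ i, Real.exp (-q i) :=
          Finset.prod_le_prod (fun i _ => sub_nonneg.2 (hq i).2) fun i _ => by
            linarith [Real.add_one_le_exp (-q i)]
      _ = Real.exp (-∑ i, q i) := by rw [← Real.exp_sum, Finset.sum_neg_distrib]
      _ ≤ Real.exp (-ε') := Real.exp_le_exp.2 (by linarith)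
      _ ≤ 1 - ε' / 2 := by
          rw [Real.exp_neg]
          refine inv_le_of_inv_le₀ (by linarith) ?_
          refine le_trans ?_ (Real.add_one_le_exp ε')
          rw [inv_le_iff_one_le_mul₀ (by linarith)]
          nlinarith
  rw [expectedMax_eq]
  exact (mul_le_mul_of_nonneg_right (by linarith) (Real.sqrt_nonneg _)).trans (key Finset.univ)

/-! ### The sweep hull and the mass outside its approximation -/

theorem massIn_mono (Q : StochasticPoints n D) {A B : Set (EuclideanSpace ℝ (Fin D))}
    (h : ∀ i, Q.pt i ∈ A → Q.pt i ∈ B) : Q.massIn A ≤ Q.massIn B := by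
  classical
  refine Finset.sum_le_sum_of_subset_of_nonneg (fun i hi => ?_) fun i _ _ => Q.prob_nonneg i
  simp only [Finset.mem_filter, Finset.mem_univ, true_and] at hi ⊢
  exact h i hi

theorem massIn_biUnion_le (Q : StochasticPoints n D) {ι : Type*} (s : Finset ι)
    (A : ι → Set (EuclideanSpace ℝ (Fin D))) :
    Q.massIn (⋃ k ∈ s, A k) ≤ ∑ k ∈ s, Q.massIn (A k) := by
  classical
  simp only [massIn, Finset.sum_filter]
  rw [Finset.sum_comm]
  refine Finset.sum_le_sum fun i _ => ?_
  have hp : ∀ k ∈ s, 0 ≤ if Q.pt i ∈ A k then Q.prob i else 0 := fun k _ => by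
    split_ifs
    exacts [Q.prob_nonneg i, le_rfl]
  split_ifs with hi
  · obtain ⟨k, hk, hik⟩ := Set.mem_iUnion₂.1 hi
    exact (if_pos hik).ge.trans (Finset.single_le_sum hp hk)
  · exact Finset.sum_nonneg hp

theorem massIn_eq_totalProb (Q : StochasticPoints n D) {A : Set (EuclideanSpace ℝ (Fin D))}
    (h : ∀ i, Q.pt i ∈ A) : Q.massIn A = Q.totalProb := by
  simp [massIn, totalProb, h]

theorem massIn_eq_zero (Q : StochasticPoints n D) {A : Set (EuclideanSpace ℝ (Fin D))}
    (h : ∀ i, Q.pt i ∉ A) : Q.massIn A = 0 := by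
  simp [massIn, h]

section sweepLevel

variable {Q : StochasticPoints n D} {ε' : ℝ} {u : EuclideanSpace ℝ (Fin D)}

theorem le_of_le_massIn (hε' : 0 < ε') {r t : ℝ} (hr : ∀ i, inner ℝ u (Q.pt i) ≤ r)
    (ht : ε' ≤ Q.massIn {x | t ≤ inner ℝ u x}) : t ≤ r := by
  by_contra! h
  rw [Q.massIn_eq_zero fun i hi => absurd (hr i) (not_le.2 (h.trans_le hi))] at ht
  linarith

theorem bddAbove_sweepLevel (hε' : 0 < ε') :
    BddAbove {t : ℝ | ε' ≤ Q.massIn {x | t ≤ inner ℝ u x}} := by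
  obtain ⟨r, hr⟩ := (Set.finite_range fun i => inner ℝ u (Q.pt i)).bddAbove
  exact ⟨r, fun t ht => le_of_le_massIn hε' (fun i => hr ⟨i, rfl⟩) ht⟩

theorem nonempty_sweepLevel (hε'Q : ε' ≤ Q.totalProb) :
    {t : ℝ | ε' ≤ Q.massIn {x | t ≤ inner ℝ u x}}.Nonempty := by
  obtain ⟨r, hr⟩ := (Set.finite_range fun i => inner ℝ u (Q.pt i)).bddBelow
  refine ⟨r, ?_⟩
  rw [Set.mem_ofPred_eq, Q.massIn_eq_totalProb fun i => hr ⟨i, rfl⟩]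
  exact hε'Q

theorem sweepLevel_le (hε' : 0 < ε') (hε'Q : ε' ≤ Q.totalProb) {r : ℝ}
    (hr : ∀ i, inner ℝ u (Q.pt i) ≤ r) : Q.sweepLevel ε' u ≤ r :=
  csSup_le (nonempty_sweepLevel hε'Q) fun _ ht => le_of_le_massIn hε' hr ht

/-- The sweep level is attained. -/
theorem le_massIn_sweepLevel (hε'Q : ε' ≤ Q.totalProb) :
    ε' ≤ Q.massIn {x | Q.sweepLevel ε' u ≤ inner ℝ u x} := by
  set t := Q.sweepLevel ε' u
  -- Finiteness leaves a gap `[t', t)` free of point values, so an admissible level above `t'`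
  -- captures only points at level `t` or beyond.
  obtain ⟨t', ht't, ht'⟩ : ∃ t' < t, ∀ i, inner ℝ u (Q.pt i) < t → inner ℝ u (Q.pt i) < t' := by
    have h1 : ∃ r < t, ∀ i, inner ℝ u (Q.pt i) < t → inner ℝ u (Q.pt i) ≤ r := by
      rcases isEmpty_or_nonempty {i // inner ℝ u (Q.pt i) < t} with h | h
      · exact ⟨t - 1, by linarith, fun i hi => (h.false ⟨i, hi⟩).elim⟩
      · obtain ⟨i, hi⟩ := Finite.exists_max
          fun i : {i // inner ℝ u (Q.pt i) < t} => inner ℝ u (Q.pt i)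
        exact ⟨_, i.2, fun j hj => hi ⟨j, hj⟩⟩
    obtain ⟨r, hrt, hr⟩ := h1
    exact ⟨(r + t) / 2, by linarith, fun i hi => by linarith [hr i hi]⟩
  obtain ⟨s, hs, ht's⟩ := exists_lt_of_lt_csSup (nonempty_sweepLevel (u := u) hε'Q) ht't
  refine hs.trans (Q.massIn_mono fun i hi => ?_)
  by_contra h
  have := ht' i (not_le.1 h)
  have h2 : s ≤ inner ℝ u (Q.pt i) := hi
  linarith

/-- With larger mass, the smallest point value above the sweep level would itself be admissible,
contradicting the supremum. -/
theorem massIn_sweepLevel_lt (hε' : 0 < ε') :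
    Q.massIn {x | Q.sweepLevel ε' u < inner ℝ u x} ≤ ε' := by
  set t := Q.sweepLevel ε' u
  rcases isEmpty_or_nonempty {i // t < inner ℝ u (Q.pt i)} with h | h
  · rw [Q.massIn_eq_zero fun i hi => h.false ⟨i, hi⟩]
    exact hε'.le
  · obtain ⟨i, hi⟩ := Finite.exists_min
      fun i : {i // t < inner ℝ u (Q.pt i)} => inner ℝ u (Q.pt i)
    by_contra! hlt
    have : inner ℝ u (Q.pt i) ≤ t := le_csSup (bddAbove_sweepLevel hε')
      (hlt.le.trans (Q.massIn_mono fun j hj => hi ⟨j, hj⟩))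
    exact absurd this (not_le.2 i.2)

/-- A halfspace that is disjoint from the sweep hull has total probability at most
`(D + 1) ε'`. -/
theorem massIn_halfspace_le (hε' : 0 < ε') {v : EuclideanSpace ℝ (Fin D)} {r : ℝ}
    (h : ∀ x ∈ Q.sweepHull ε', inner ℝ v x ≤ r) :
    Q.massIn {x | r < inner ℝ v x} ≤ (D + 1) * ε' := by
  set B := convexHull ℝ {x | x ∈ Set.range Q.pt ∧ r < inner ℝ v x}
  have hBc : IsCompact B :=
    ((Set.finite_range Q.pt).subset fun x hx => hx.1).isCompact_convexHull ℝ
  have hB : ∀ x ∈ B, r < inner ℝ v x := fun x hx =>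
    convexHull_min (t := {x | r < inner ℝ v x}) (fun y hy => hy.2)
      (convex_halfSpace_gt (innerₛₗ ℝ v).isLinear r) hx
  rcases B.eq_empty_or_nonempty with hBe | hBne
  · rw [Q.massIn_eq_zero fun i hi => ?_]
    · positivity
    · exact (Set.eq_empty_iff_forall_notMem.1 hBe) (Q.pt i)
        (subset_convexHull ℝ _ ⟨⟨i, rfl⟩, hi⟩)
  let F : {u : EuclideanSpace ℝ (Fin D) // ‖u‖ = 1} → Set (EuclideanSpace ℝ (Fin D)) :=
    fun u => B ∩ {x | inner ℝ u.1 x ≤ Q.sweepLevel ε' u.1}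
  have hclosed : ∀ u, IsClosed {x | inner ℝ u x ≤ Q.sweepLevel ε' u} := fun u =>
    isClosed_le (by fun_prop) continuous_const
  -- A direction is required because an intersection over no directions would not be confined to
  -- `B`.
  by_cases hne : (⋂ u, F u).Nonempty ∧ Nonempty {u : EuclideanSpace ℝ (Fin D) // ‖u‖ = 1}
  · obtain ⟨⟨x, hx⟩, ⟨u₀⟩⟩ := hne
    rw [Set.mem_iInter] at hx
    exact absurd (h x fun u hu => (hx ⟨u, hu⟩).2) (not_le.2 (hB x (hx u₀).1))
  -- Compact Helly: `B` misses the sweep hull, so it already misses an intersection of at most `D +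
  -- 1` sweep halfspaces, and their open complements cover `B`.
  have hex : ∃ I : Finset {u : EuclideanSpace ℝ (Fin D) // ‖u‖ = 1}, I.card ≤ D + 1 ∧
      ∀ x ∈ B, ∃ u ∈ I, Q.sweepLevel ε' u.1 < inner ℝ u.1 x := by
    by_contra! hcon
    apply hne
    constructor
    · refine Convex.helly_theorem_compact' (𝕜 := ℝ) (fun u => (convex_convexHull ℝ _).inter
        (convex_halfSpace_le (innerₛₗ ℝ u.1).isLinear _)) (fun u => hBc.inter_right (hclosed _))
        fun I hI => ?_
      rw [finrank_euclideanSpace_fin] at hI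
      obtain ⟨x, hxB, hx⟩ := hcon I hI
      exact ⟨x, Set.mem_iInter₂.2 fun u hu => ⟨hxB, hx u hu⟩⟩
    · by_contra hE
      rw [not_nonempty_iff] at hE
      obtain ⟨x, hx⟩ := hBne
      exact absurd (h x fun u hu => (hE.false ⟨u, hu⟩).elim) (not_le.2 (hB x hx))
  obtain ⟨I, hI, hcov⟩ := hex
  calc Q.massIn {x | r < inner ℝ v x}
      ≤ Q.massIn (⋃ u ∈ I, {x | Q.sweepLevel ε' u.1 < inner ℝ u.1 x}) := by
        refine Q.massIn_mono fun i hi => ?_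
        obtain ⟨u, hu, hlt⟩ := hcov (Q.pt i) (subset_convexHull ℝ _ ⟨⟨i, rfl⟩, hi⟩)
        exact Set.mem_iUnion₂.2 ⟨u, hu, hlt⟩
    _ ≤ ∑ u ∈ I, Q.massIn {x | Q.sweepLevel ε' u.1 < inner ℝ u.1 x} := Q.massIn_biUnion_le _ _
    _ ≤ ∑ _u ∈ I, ε' := Finset.sum_le_sum fun u _ => massIn_sweepLevel_lt hε'
    _ ≤ (D + 1) * ε' := by
        rw [Finset.sum_const, nsmul_eq_mul]
        gcongr
        exact_mod_cast hI

theorem massIn_compl_le (hε' : 0 < ε') {K : Set (EuclideanSpace ℝ (Fin D))} {m : ℕ}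
    (hK : IsInterHalfspaces m K) (hHK : Q.sweepHull ε' ⊆ K) :
    Q.massIn Kᶜ ≤ m * ((D + 1) * ε') := by
  obtain ⟨v, r, -, rfl⟩ := hK
  calc Q.massIn {x | ∀ k, inner ℝ (v k) x ≤ r k}ᶜ
      ≤ Q.massIn (⋃ k ∈ (Finset.univ : Finset (Fin m)), {x | r k < inner ℝ (v k) x}) :=
        Q.massIn_mono fun i hi => by simpa using hi
    _ ≤ ∑ k, Q.massIn {x | r k < inner ℝ (v k) x} := Q.massIn_biUnion_le _ _
    _ ≤ ∑ _k : Fin m, (D + 1) * ε' :=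
        Finset.sum_le_sum fun k _ => massIn_halfspace_le hε' fun x hx => hHK hx k
    _ = _ := by simp

/-- If some point lies in an outer approximation `K` of the sweep hull, then in each direction of
the polar set the points in `K` extend at most twice as far as the sweep level. -/
theorem IsOuterApprox.exists_level (hε' : 0 < ε') (hε'Q : ε' ≤ Q.totalProb)
    {K : Set (EuclideanSpace ℝ (Fin D))} {ε : ℝ} (hε : 0 < ε) (hε1 : ε ≤ 1 / 2)
    (hK : Q.IsOuterApprox ε ε' K) (hne : K.Nonempty) (hu : u ∈ Q.polar) :
    ∃ t, 0 ≤ t ∧ ε' ≤ Q.massIn {x | t ≤ inner ℝ u x} ∧ ∀ x ∈ K, inner ℝ u x ≤ 2 * t := by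
  -- Sweep halfspaces are only imposed in unit directions; levels scale with `‖u‖`, and `u = 0`
  -- takes `t = 0`.
  wlog hu1 : ‖u‖ = 1 generalizing u
  · rcases eq_or_ne u 0 with rfl | hu0
    · refine ⟨0, le_rfl, ?_, by simp⟩
      rw [Q.massIn_eq_totalProb (by simp)]
      exact hε'Q
    have hpos : 0 < ‖u‖ := norm_pos_iff.2 hu0
    have hin : ∀ x, inner ℝ (‖u‖⁻¹ • u) x * ‖u‖ = inner ℝ u x := fun x => by
      rw [real_inner_smul_left]
      field_simp
    obtain ⟨t, ht, hmass, hKt⟩ := this (u := ‖u‖⁻¹ • u)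
      (fun i => by
        rw [real_inner_smul_left]
        exact mul_nonneg (by positivity) (hu i))
      (by rw [norm_smul, norm_inv, norm_norm, inv_mul_cancel₀ hpos.ne'])
    refine ⟨t * ‖u‖, by positivity, hmass.trans (Q.massIn_mono fun i hi => ?_), fun x hx => ?_⟩
    · rw [Set.mem_ofPred_eq, ← hin]
      exact mul_le_mul_of_nonneg_right hi hpos.le
    · rw [← hin, ← mul_assoc]
      exact mul_le_mul_of_nonneg_right (hKt x hx) hpos.le
  obtain ⟨⟨c, hc⟩, hHK⟩ := hK
  have hhom : ∀ x, inner ℝ u (AffineMap.homothety c (1 - ε) x) =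
      (1 - ε) * inner ℝ u x + ε * inner ℝ u c := fun x => by
    simp only [AffineMap.homothety_apply, vsub_eq_sub, vadd_eq_add, inner_add_right,
      real_inner_smul_right, inner_sub_right]
    ring
  have hH : ∀ x ∈ K, AffineMap.homothety c (1 - ε) x ∈ Q.sweepHull ε' := fun x hx =>
    hc (Set.mem_image_of_mem _ hx)
  -- The sweep level in direction `-u` is at most `0`, since `u` is polar.
  have hH0 : ∀ x ∈ Q.sweepHull ε', 0 ≤ inner ℝ u x := fun x hx => by
    have h1 := hx (-u) (by rwa [norm_neg])
    have h2 := sweepLevel_le (u := -u) hε' hε'Q (r := 0) fun i => by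
      rw [inner_neg_left]
      linarith [hu i]
    rw [inner_neg_left] at h1
    linarith
  -- The homothety maps the hull into itself. Comparing infima of `u` gives `⟨u, c⟩ ≥ sInf Z ≥ 0`;
  -- no minimizer needs to exist.
  have hc0 : 0 ≤ inner ℝ u c := by
    set Z := (fun x => inner ℝ u x) '' Q.sweepHull ε'
    have hZ : BddBelow Z := ⟨0, by rintro _ ⟨x, hx, rfl⟩; exact hH0 x hx⟩
    obtain ⟨x₀, hx₀⟩ := hne
    have hZne : Z.Nonempty := ⟨_, Set.mem_image_of_mem _ (hH x₀ hx₀)⟩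
    have h0 : 0 ≤ sInf Z := le_csInf hZne (by rintro _ ⟨x, hx, rfl⟩; exact hH0 x hx)
    have h1 : (sInf Z - ε * inner ℝ u c) / (1 - ε) ≤ sInf Z := by
      refine le_csInf hZne ?_
      rintro _ ⟨x, hx, rfl⟩
      have := csInf_le hZ (Set.mem_image_of_mem (fun x => inner ℝ u x) (hH x (hHK hx)))
      simp only [hhom] at this
      rw [div_le_iff₀ (by linarith)]
      linarith
    rw [div_le_iff₀ (by linarith)] at h1
    nlinarith
  refine ⟨Q.sweepLevel ε' u, ?_, le_massIn_sweepLevel hε'Q, fun x hx => ?_⟩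
  · refine le_csSup (bddAbove_sweepLevel hε') ?_
    rw [Set.mem_ofPred_eq, Q.massIn_eq_totalProb (A := {x | 0 ≤ inner ℝ u x}) hu]
    exact hε'Q
  -- Dropping the centre term leaves `(1 - ε)⟨u, x⟩ ≤ t`, and `1 - ε ≥ 1 / 2` yields the factor `2`.
  · have h1 := hH x hx u hu1
    rw [hhom] at h1
    have h2 := hH0 _ (hH x hx)
    rw [hhom] at h2
    have h3 := mul_nonneg hε.le hc0
    rcases le_total 0 (inner ℝ u x) with h0 | h0
    · nlinarith
    · linarith

end sweepLevel

end StochasticPoints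

/-! ### Union bound and uniform convergence -/

theorem sum_filter_le_sum_sum_filter {α β : Type*} (s : Finset α) (R : Finset β) (f : α → ℝ)
    (hf : ∀ x ∈ s, 0 ≤ f x) (p : α → Prop) [DecidablePred p] (B : β → α → Prop)
    [∀ r, DecidablePred (B r)] (h : ∀ x ∈ s, p x → ∃ r ∈ R, B r x) :
    ∑ x ∈ s with p x, f x ≤ ∑ r ∈ R, ∑ x ∈ s with B r x, f x := by
  simp only [Finset.sum_filter]
  rw [Finset.sum_comm]
  refine Finset.sum_le_sum fun x hx => ?_
  have hp : ∀ r ∈ R, 0 ≤ if B r x then f x else 0 := fun r _ => by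
    split_ifs
    exacts [hf x hx, le_rfl]
  split_ifs with hpx
  · obtain ⟨r, hr, hB⟩ := h x hx hpx
    exact (if_pos hB).ge.trans (Finset.single_le_sum hp hr)
  · exact Finset.sum_nonneg hp

namespace StochasticPoints

variable {n D : ℕ}

theorem sampleProb_mono (Q : StochasticPoints n D) {I : Finset (Fin n)} {N : ℕ}
    {e e' : (Fin N → Finset (Fin n)) → Prop} (h : ∀ S, (∀ k, S k ⊆ I) → e S → e' S) :
    Q.sampleProb I N e ≤ Q.sampleProb I N e' := by
  classical
  unfold sampleProb
  refine Finset.sum_le_sum_of_subset_of_nonneg (fun S hS => ?_) fun S _ _ =>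
    Finset.prod_nonneg fun k _ => Q.realizationProb_nonneg I _
  rw [Finset.mem_filter] at hS ⊢
  exact ⟨hS.1, h S (fun k => Finset.mem_powerset.1 (Fintype.mem_piFinset.1 hS.1 k)) hS.2⟩

/-- Hoeffding's inequality with a union bound over a finite family `R` of statistics. -/
theorem le_sampleProb_forall_mem (Q : StochasticPoints n D) (I : Finset (Fin n)) {N : ℕ}
    {β : Type*} (R : Finset β) (g : β → Finset (Fin n) → ℝ)
    (hg : ∀ r ∈ R, ∀ P ⊆ I, g r P ∈ Set.Icc (0 : ℝ) 1) {τ : ℝ} (hτ : 0 ≤ τ) (hτ1 : τ ≤ 1) :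
    1 - 2 * R.card * Real.exp (-(τ ^ 2 * N / 4)) ≤ Q.sampleProb I N (fun S =>
      ∀ r ∈ R, |∑ k, (g r (S k) - Q.expectOn I (g r))| ≤ τ * N) := by
  classical
  set s := Fintype.piFinset fun _ : Fin N => I.powerset
  set w := fun S : Fin N → Finset (Fin n) => ∏ k, Q.realizationProb I (S k)
  set p := fun S : Fin N → Finset (Fin n) =>
    ∀ r ∈ R, |∑ k, (g r (S k) - Q.expectOn I (g r))| ≤ τ * N
  have htot : ∑ S ∈ s, w S = 1 := by
    rw [Finset.sum_prod_piFinset I.powerset (fun (_ : Fin N) P => Q.realizationProb I P)]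
    simp [sum_realizationProb]
  have hsplit := Finset.sum_filter_add_sum_filter_not s p w
  have hgood : Q.sampleProb I N p = ∑ S ∈ s with p S, w S := by
    unfold sampleProb
    congr!
  -- The sign splits each two-sided deviation into two one-sided Chernoff events.
  let B : β × ℝ → (Fin N → Finset (Fin n)) → Prop := fun x S =>
    τ * N ≤ ∑ k, x.2 * (g x.1 (S k) - Q.expectOn I (g x.1))
  have hbad : ∑ S ∈ s with ¬ p S, w S ≤
      ∑ x ∈ R ×ˢ ({1, -1} : Finset ℝ), ∑ S ∈ s with B x S, w S := by
    refine sum_filter_le_sum_sum_filter s _ w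
      (fun S _ => Finset.prod_nonneg fun k _ => Q.realizationProb_nonneg I _) _ B fun S _ hS => ?_
    simp only [p, not_forall, not_le] at hS
    obtain ⟨r, hr, hlt⟩ := hS
    rcases lt_abs.1 hlt with h | h
    · exact ⟨(r, 1), by simp [hr], by simpa [B] using h.le⟩
    · refine ⟨(r, -1), by simp [hr], ?_⟩
      simp only [B, ← Finset.mul_sum]
      linarith
  have htail : ∀ x ∈ R ×ˢ ({1, -1} : Finset ℝ),
      ∑ S ∈ s with B x S, w S ≤ Real.exp (-(τ ^ 2 * N / 4)) := fun x hx => by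
    obtain ⟨hr, hσ⟩ := Finset.mem_product.1 hx
    have hσ1 : |x.2| = 1 := by
      simp only [Finset.mem_insert, Finset.mem_singleton] at hσ
      rcases hσ with h | h <;> simp [h]
    have hE0 : 0 ≤ Q.expectOn I (g x.1) := by
      rw [← Q.expectOn_const I 0]
      exact Q.expectOn_mono fun P hP => (hg _ hr P hP).1
    have hE1 : Q.expectOn I (g x.1) ≤ 1 := by
      conv_rhs => rw [← Q.expectOn_const I 1]
      exact Q.expectOn_mono fun P hP => (hg _ hr P hP).2
    refine sum_piFinset_prod_le_exp I.powerset (Q.realizationProb I)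
      (fun P => x.2 * (g x.1 P - Q.expectOn I (g x.1)))
      (fun P _ => Q.realizationProb_nonneg I P) (Q.sum_realizationProb I) (fun P hP => ?_) ?_ hτ
      hτ1 N _ (Finset.filter_subset _ _) fun S hS => (Finset.mem_filter.1 hS).2
    · rw [abs_mul, hσ1, one_mul, abs_le]
      have := hg _ hr P (Finset.mem_powerset.1 hP)
      exact ⟨by linarith [this.1], by linarith [this.2]⟩
    · change Q.expectOn I (fun P => x.2 * (g x.1 P - Q.expectOn I (g x.1))) = 0
      simp only [sub_eq_add_neg]
      rw [expectOn_const_mul, expectOn_add_const]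
      ring
  have hcard : ((R ×ˢ ({1, -1} : Finset ℝ)).card : ℝ) ≤ 2 * R.card := by
    rw [Finset.card_product, mul_comm]
    exact_mod_cast Nat.mul_le_mul_right _ Finset.card_le_two
  have hsum := (Finset.sum_le_card_nsmul _ _ _ htail)
  rw [nsmul_eq_mul] at hsum
  have := mul_le_mul_of_nonneg_right hcard (Real.exp_nonneg (-(τ ^ 2 * N / 4)))
  rw [hgood]
  linarith

theorem abs_expectOn_sub_le (Q : StochasticPoints n D) {I : Finset (Fin n)}
    {F G : Finset (Fin n) → ℝ} {η : ℝ} (h : ∀ P ⊆ I, |F P - G P| ≤ η) :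
    |Q.expectOn I F - Q.expectOn I G| ≤ η := by
  have h1 := Q.expectOn_mono (I := I) (F := F) (G := fun P => G P + η)
    fun P hP => by linarith [(abs_le.1 (h P hP)).2]
  have h2 := Q.expectOn_mono (I := I) (F := G) (G := fun P => F P + η)
    fun P hP => by linarith [(abs_le.1 (h P hP)).1]
  rw [expectOn_add_const] at h1 h2
  exact abs_le.2 ⟨by linarith, by linarith⟩

/-- Uniform convergence of the empirical mean of `max_{x ∈ P} ⟨u, x⟩^{1/2}` over all functionals
`u` that are nonnegative on the points, relative to the width of the point set. -/
theorem le_sampleProb_uniform (Q : StochasticPoints n D) (I : Finset (Fin n)) {N q : ℕ}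
    (hN : 0 < N) (hq : 0 < q) {τ η : ℝ} (hτ : 0 ≤ τ) (hτ1 : τ ≤ 1) (hη : 0 ≤ η)
    (hqη : (D : ℝ) / q ≤ η ^ 2) :
    1 - 2 * ((q : ℝ) + 1) ^ D * Real.exp (-(τ ^ 2 * N / 4)) ≤ Q.sampleProb I N (fun S =>
      ∀ (u : EuclideanSpace ℝ (Fin D)) (W : ℝ), 0 ≤ W →
        (∀ i ∈ I, inner ℝ u (Q.pt i) ∈ Set.Icc 0 W) →
        |1 / (N : ℝ) * ∑ k, Q.maxOn u (S k) - Q.expectOn I (Q.maxOn u)| ≤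
          (τ + 2 * η) * √W) := by
  have hN' : (0 : ℝ) < N := by exact_mod_cast hN
  obtain ⟨R, hRcard, hR01, hRnet⟩ := exists_finset_functional_net (V := Q.pt '' I)
    (I.finite_toSet.image _) hq
  have hR01' : ∀ u ∈ R, ∀ i ∈ I, inner ℝ u (Q.pt i) ∈ Set.Icc (0 : ℝ) 1 := fun u hu i hi =>
    hR01 u hu _ (Set.mem_image_of_mem _ hi)
  have hconc := Q.le_sampleProb_forall_mem I (N := N) R Q.maxOn (fun u hu P hP =>
    ⟨Q.maxOn_nonneg u P, maxOn_le zero_le_one fun i hi =>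
      Real.sqrt_le_one.2 (hR01' u hu i (hP hi)).2⟩) hτ hτ1
  have hcard : (R.card : ℝ) ≤ ((q : ℝ) + 1) ^ D := by exact_mod_cast hRcard
  refine le_trans ?_ (hconc.trans (Q.sampleProb_mono fun S hSI hS u W hW hu => ?_))
  · have := mul_le_mul_of_nonneg_right hcard (Real.exp_nonneg (-(τ ^ 2 * N / 4)))
    linarith
  rcases hW.eq_or_lt with rfl | hWpos
  · have h0 : ∀ P ⊆ I, Q.maxOn u P = 0 := fun P hP =>
      le_antisymm (maxOn_le le_rfl fun i hi => by
        rw [Real.sqrt_eq_zero_of_nonpos (hu i (hP hi)).2]) (Q.maxOn_nonneg u P)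
    have hE : Q.expectOn I (Q.maxOn u) = 0 :=
      Finset.sum_eq_zero fun P hP => by rw [h0 P (Finset.mem_powerset.1 hP), mul_zero]
    simp [hE, fun k => h0 (S k) (hSI k)]
  -- Normalize the width to `1`; degree-`1/2` homogeneity returns the factor `√W`.
  set v := W⁻¹ • u
  have hv : ∀ i ∈ I, inner ℝ v (Q.pt i) ∈ Set.Icc (0 : ℝ) 1 := fun i hi => by
    rw [real_inner_smul_left, inv_mul_eq_div]
    exact ⟨div_nonneg (hu i hi).1 hW, div_le_one_of_le₀ (hu i hi).2 hW⟩
  have huv : Q.maxOn u = fun P => √W * Q.maxOn v P := by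
    funext P
    have : u = W • v := by rw [smul_inv_smul₀ hWpos.ne']
    rw [maxOn, this, maxSqrtInner_smul hW, maxOn]
  obtain ⟨v', hv'R, hv'⟩ := hRnet v (by rintro _ ⟨i, hi, rfl⟩; exact hv i hi)
  have hclose : ∀ P ⊆ I, |Q.maxOn v P - Q.maxOn v' P| ≤ η := fun P hP => by
    have hpt : ∀ x ∈ Q.points P, |inner ℝ v x - inner ℝ v' x| ≤ η ^ 2 := fun x hx => by
      obtain ⟨i, hi, rfl⟩ := mem_points.1 hx
      exact (hv' _ (Set.mem_image_of_mem _ (hP hi))).trans hqη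
    have h1 : Q.maxOn v P ≤ Q.maxOn v' P + η := maxSqrtInner_le_add hη fun x hx => by
      linarith [(abs_le.1 (hpt x hx)).2]
    have h2 : Q.maxOn v' P ≤ Q.maxOn v P + η := maxSqrtInner_le_add hη fun x hx => by
      linarith [(abs_le.1 (hpt x hx)).1]
    exact abs_le.2 ⟨by linarith, by linarith⟩
  have hE := Q.abs_expectOn_sub_le hclose
  have hA : |∑ k, Q.maxOn v (S k) - ∑ k, Q.maxOn v' (S k)| ≤ η * N := by
    rw [← Finset.sum_sub_distrib]
    refine (Finset.abs_sum_le_sum_abs _ _).trans ?_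
    refine (Finset.sum_le_card_nsmul _ _ η fun k _ => hclose (S k) (hSI k)).trans_eq ?_
    simp [mul_comm]
  have hC := hS v' hv'R
  simp only [Finset.sum_sub_distrib, Finset.sum_const, Finset.card_univ, Fintype.card_fin,
    nsmul_eq_mul] at hC
  -- `τ` is the deviation at the net functional; `η` is paid once for the empirical mean and once
  -- for the expectation.
  have hfin : |1 / (N : ℝ) * ∑ k, Q.maxOn v (S k) - Q.expectOn I (Q.maxOn v)| ≤ τ + 2 * η := by
    have heq : 1 / (N : ℝ) * ∑ k, Q.maxOn v (S k) - Q.expectOn I (Q.maxOn v) =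
        (∑ k, Q.maxOn v (S k) - N * Q.expectOn I (Q.maxOn v)) / N := by
      field_simp
    rw [heq, abs_div, abs_of_pos hN', div_le_iff₀ hN']
    rw [abs_le] at hE hA hC ⊢
    have e1 := mul_le_mul_of_nonneg_left hE.1 hN'.le
    have e2 := mul_le_mul_of_nonneg_left hE.2 hN'.le
    constructor <;> linarith [hA.1, hA.2, hC.1, hC.2]
  rw [huv, expectOn_const_mul, ← Finset.mul_sum, mul_left_comm, ← mul_sub, abs_mul,
    abs_of_nonneg (Real.sqrt_nonneg W), mul_comm]
  gcongr

end StochasticPoints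

/-! ### Choice of constants and conclusion -/

/-- The size of the net of functionals is absorbed by the sample size. -/
theorem two_mul_pow_mul_exp_le {D : ℕ} (hD : 1 ≤ D) {A₁ ε ε' δ s N : ℝ} (hε : 0 < ε)
    (hε1 : ε ≤ 1 / 2) (hε'1 : ε' ≤ 1) (hδ : 0 < δ) (hδ1 : δ < 1)
    (hA₁ : ε ^ (A₁ * D) ≤ ε') (hs : 1 ≤ s)
    (hN : 256 * ((Real.log 2 + D * Real.log (258 * D)) / Real.log 2 + 2 * D * (1 + A₁ * D) + 1) *
      ((ε' * ε) ^ 2)⁻¹ * (s * Real.log (1 / ε) + Real.log (1 / δ)) ≤ N)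
    (hA₁0 : 0 < A₁) :
    2 * ((⌈256 * D / (ε' * ε) ^ 2⌉₊ : ℝ) + 1) ^ D *
      Real.exp (-((ε' * ε / 8) ^ 2 * N / 4)) ≤ δ := by
  have hD' : (1 : ℝ) ≤ D := by exact_mod_cast hD
  have hε' : 0 < ε' := (Real.rpow_pos_of_pos hε _).trans_le hA₁
  have hσ : 0 < ε' * ε := mul_pos hε' hε
  have hσ1 : ε' * ε ≤ 1 := mul_le_one₀ hε'1 hε.le (by linarith)
  have hlog2 : 0 < Real.log 2 := Real.log_pos (by norm_num)
  set L := Real.log (1 / ε)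
  have hL : Real.log 2 ≤ L := Real.log_le_log (by norm_num) (by
    rw [le_div_iff₀ hε]
    linarith)
  have hl : 0 < Real.log (1 / δ) := Real.log_pos (by rw [lt_div_iff₀ hδ]; linarith)
  set c₁ := Real.log 2 + D * Real.log (258 * D)
  have hc₁ : 0 ≤ c₁ := add_nonneg hlog2.le
    (mul_nonneg (by linarith) (Real.log_nonneg (by linarith)))
  set C₀ := c₁ / Real.log 2 + 2 * D * (1 + A₁ * D)
  have hC₀ : 0 ≤ C₀ := by positivity
  have hσL : Real.exp (-((1 + A₁ * D) * L)) ≤ ε' * ε := by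
    have h1 : Real.exp (-((1 + A₁ * D) * L)) = ε ^ (A₁ * D) * ε := by
      have h2 : -((1 + A₁ * D) * L) = Real.log ε * (A₁ * D) + Real.log ε := by
        simp only [L, one_div, Real.log_inv]
        ring
      rw [h2, Real.exp_add, Real.exp_log hε, Real.rpow_def_of_pos hε]
    rw [h1]
    gcongr
  -- Rounding up and the extra cell cost `2`, whence `258`.
  have hq : (⌈256 * D / (ε' * ε) ^ 2⌉₊ : ℝ) + 1 ≤
      258 * D * Real.exp (2 * ((1 + A₁ * D) * L)) := by
    have h1 := (Nat.ceil_lt_add_one (a := 256 * D / (ε' * ε) ^ 2) (by positivity)).le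
    have h2 : ((ε' * ε) ^ 2)⁻¹ ≤ Real.exp (2 * ((1 + A₁ * D) * L)) := by
      have : Real.exp (2 * ((1 + A₁ * D) * L)) = (Real.exp (-((1 + A₁ * D) * L)) ^ 2)⁻¹ := by
        rw [← Real.exp_nat_mul, ← Real.exp_neg]
        push_cast
        ring_nf
      rw [this]
      gcongr
    have h3 : 1 ≤ ((ε' * ε) ^ 2)⁻¹ := one_le_inv₀ (by positivity) |>.2 (pow_le_one₀ hσ.le hσ1)
    calc (⌈256 * D / (ε' * ε) ^ 2⌉₊ : ℝ) + 1 ≤ 256 * D * ((ε' * ε) ^ 2)⁻¹ + 2 := by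
          rw [div_eq_mul_inv] at h1 ⊢
          linarith
      _ ≤ 258 * D * ((ε' * ε) ^ 2)⁻¹ := by nlinarith
      _ ≤ _ := by gcongr
  -- The part `c₁` without a factor `L` is absorbed using `L ≥ log 2`.
  have hq2 : 2 * ((⌈256 * D / (ε' * ε) ^ 2⌉₊ : ℝ) + 1) ^ D ≤ Real.exp (C₀ * L) := by
    calc 2 * ((⌈256 * D / (ε' * ε) ^ 2⌉₊ : ℝ) + 1) ^ D
        ≤ 2 * (258 * D * Real.exp (2 * ((1 + A₁ * D) * L))) ^ D := by gcongr
      _ = Real.exp (c₁ + 2 * D * (1 + A₁ * D) * L) := by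
          rw [← Real.exp_log (show (0 : ℝ) < 258 * D by linarith), ← Real.exp_add,
            ← Real.exp_nat_mul]
          nth_rewrite 1 [← Real.exp_log (show (0 : ℝ) < 2 by norm_num)]
          rw [← Real.exp_add]
          simp only [c₁]
          ring_nf
      _ ≤ Real.exp (C₀ * L) := by
          refine Real.exp_le_exp.2 ?_
          have : c₁ ≤ c₁ / Real.log 2 * L := by
            rw [div_mul_eq_mul_div, le_div_iff₀ hlog2]
            gcongr
          simp only [C₀]
          linarith
  -- The factor `256` cancels `8 ^ 2 * 4`. Of `s`, only `s ≥ 1` matters.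
  have hexp : C₀ * L + Real.log (1 / δ) ≤ (ε' * ε / 8) ^ 2 * N / 4 := by
    have h1 : (C₀ + 1) * (s * L + Real.log (1 / δ)) =
        (ε' * ε / 8) ^ 2 * (256 * (C₀ + 1) * ((ε' * ε) ^ 2)⁻¹ *
          (s * L + Real.log (1 / δ))) / 4 := by
      field_simp
      ring
    have h2 : (C₀ + 1) * (s * L + Real.log (1 / δ)) ≤ (ε' * ε / 8) ^ 2 * N / 4 := by
      rw [h1]
      gcongr
    have h3 : L ≤ s * L := le_mul_of_one_le_left (hlog2.le.trans hL) hs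
    nlinarith [mul_le_mul_of_nonneg_left h3 hC₀, mul_nonneg hC₀ hl.le, hlog2.trans_le hL]
  calc _ ≤ Real.exp (C₀ * L) * Real.exp (-(C₀ * L + Real.log (1 / δ))) := by gcongr
    _ = δ := by
      rw [← Real.exp_add, one_div, Real.log_inv]
      ring_nf
      exact Real.exp_log hδ

namespace StochasticPoints

variable {n D : ℕ}

theorem massIn_compl_eq (Q : StochasticPoints n D) (K : Set (EuclideanSpace ℝ (Fin D))) :
    Q.massIn Kᶜ = ∑ i ∈ Q.outside K, Q.prob i := by
  unfold massIn outside
  congr!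

theorem mem_inside {Q : StochasticPoints n D} {K : Set (EuclideanSpace ℝ (Fin D))} {i : Fin n} :
    i ∈ Q.inside K ↔ Q.pt i ∈ K := by
  simp [inside]

/-- The estimate is accurate once the empirical mean over the points in `K` is. -/
theorem estimate_mem_Icc (Q : StochasticPoints n D) {K : Set (EuclideanSpace ℝ (Fin D))}
    {ε : ℝ} (hε : 0 < ε) (hε1 : ε ≤ 1 / 2) {N : ℕ} {S : Fin N → Finset (Fin n)}
    {E : Fin N → Finset (EuclideanSpace ℝ (Fin D))}
    (hE : ∀ k, IsEpsKernel ε (Q.points (S k) : Set (EuclideanSpace ℝ (Fin D))) (E k))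
    {u : EuclideanSpace ℝ (Fin D)} (hu : u ∈ Q.polar)
    (hout : ∑ i ∈ Q.outside K, Q.prob i ≤ ε / 2)
    (hdev : |1 / (N : ℝ) * ∑ k, Q.maxOn u (S k) - Q.expectOn (Q.inside K) (Q.maxOn u)| ≤
      ε * Q.expectedMax u) :
    Q.estimate K E u ∈
      Set.Icc ((1 - 4 * ε) * Q.expectedMax u) ((1 + 4 * ε) * Q.expectedMax u) := by
  have hdisj : Disjoint (Q.inside K) (Q.outside K) := by
    classical
    unfold inside outside
    exact Finset.disjoint_filter_filter_not _ _ _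
  have hunion : Q.inside K ∪ Q.outside K = Finset.univ := by
    ext i
    simp [inside, outside, em]
  have hup := Q.expectOn_union_le u hdisj
  have hlow := Q.le_expectOn_union u hdisj (by linarith)
  rw [hunion, ← expectedMax_eq] at hup hlow
  have hY := Q.expectOn_maxOn_nonneg u (Q.inside K)
  have hX : 0 ≤ Q.expectedMax u := by
    rw [expectedMax_eq]
    exact Q.expectOn_maxOn_nonneg u _
  have hT : 0 ≤ ∑ i ∈ Q.outside K, Q.prob i * √(inner ℝ u (Q.pt i)) :=
    Finset.sum_nonneg fun i _ => mul_nonneg (Q.prob_nonneg i) (Real.sqrt_nonneg _)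
  have hker : ∀ k, maxSqrtInner u (E k) ∈
      Set.Icc ((1 - ε) * Q.maxOn u (S k)) (Q.maxOn u (S k)) := fun k =>
    (hE k).maxSqrtInner_mem_Icc hε (by linarith) fun x hx => by
      obtain ⟨i, -, rfl⟩ := mem_points.1 hx
      exact hu i
  have hE1 : 1 / (N : ℝ) * ∑ k, maxSqrtInner u (E k) ≤ 1 / (N : ℝ) * ∑ k, Q.maxOn u (S k) := by
    gcongr with k
    exact (hker k).2
  have hE0 : (1 - ε) * (1 / (N : ℝ) * ∑ k, Q.maxOn u (S k)) ≤
      1 / (N : ℝ) * ∑ k, maxSqrtInner u (E k) := by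
    rw [mul_left_comm, Finset.mul_sum]
    gcongr with k
    exact (hker k).1
  rw [abs_le] at hdev
  unfold estimate
  generalize 1 / (N : ℝ) * ∑ k, Q.maxOn u (S k) = V at *
  generalize 1 / (N : ℝ) * ∑ k, maxSqrtInner u (E k) = V' at *
  generalize ∑ i ∈ Q.outside K, Q.prob i * √(inner ℝ u (Q.pt i)) = T at *
  generalize Q.expectOn (Q.inside K) (Q.maxOn u) = Y at *
  generalize Q.expectedMax u = X at *
  generalize ∑ i ∈ Q.outside K, Q.prob i = μ at *
  -- The outside mass `μ ≤ ε / 2` gives `X ≤ Y + T ≤ (1 + ε) X`; sampling and kernel errors come on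
  -- top of this.
  have h1 : (1 - ε / 2) * (Y + T) ≤ X :=
    (mul_le_mul_of_nonneg_right (by linarith) (by linarith)).trans hlow
  have h2 : Y + T ≤ 2 * X := by nlinarith
  have h3 : Y + T ≤ (1 + ε) * X := by nlinarith
  have h4 : (1 - ε) * (Y - ε * X) ≤ (1 - ε) * V :=
    mul_le_mul_of_nonneg_left (by linarith) (by linarith)
  constructor
  · nlinarith [mul_nonneg hε.le hX, mul_nonneg hε.le hT, mul_nonneg hε.le (mul_nonneg hε.le hX)]
  · nlinarith [mul_nonneg hε.le hX]

end StochasticPoints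

theorem mainTheorem9 :
    ∀ a : ℝ, 0 < a → ∃ A : ℝ, 0 < A ∧
    ∀ D : ℕ, 1 ≤ D → ∀ b : ℝ, 0 < b → ∃ c : ℝ, 0 < c ∧
    ∀ A₁ : ℝ, 0 < A₁ → ∃ C : ℝ, 0 < C ∧
    ∀ (n : ℕ) (Q : StochasticPoints n D) (ε ε' δ : ℝ) (K : Set (EuclideanSpace ℝ (Fin D)))
      (m N : ℕ),
      0 < ε → ε ≤ 1 / 2 →
      0 < δ → δ < 1 →
      ε ^ (A₁ * D) ≤ ε' → ε' ≤ c * ε ^ (A * D) →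
      ε ≤ Q.totalProb →
      IsInterHalfspaces m K → (m : ℝ) ≤ b * ε ^ (-(a * D)) →
      Q.IsOuterApprox ε ε' K →
      C * ((ε' * ε) ^ 2)⁻¹ * (ε ^ (-(A * D)) * Real.log (1 / ε) + Real.log (1 / δ)) ≤ (N : ℝ) →
      1 - δ ≤ Q.sampleProb (Q.inside K) N (fun S =>
        ∀ E : Fin N → Finset (EuclideanSpace ℝ (Fin D)),
          (∀ k, IsEpsKernel ε (Q.points (S k) : Set (EuclideanSpace ℝ (Fin D))) (E k)) →
          ∀ u ∈ Q.polar,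
            Q.estimate K E u ∈
              Set.Icc ((1 - 4 * ε) * Q.expectedMax u) ((1 + 4 * ε) * Q.expectedMax u)) := by
  intro a ha
  -- With `A = a + 1`, the product of `m` and `ε'` is of order `ε ^ D ≤ ε`.
  refine ⟨a + 1, by linarith, fun D hD b hb => ?_⟩
  have hD' : (1 : ℝ) ≤ D := by exact_mod_cast hD
  -- The second term makes the outside mass at most `ε / 2`; the first ensures `ε' ≤ ε`.
  refine ⟨min 1 (1 / (2 * b * (D + 1))), by positivity, fun A₁ hA₁ => ?_⟩
  have hlog2 : 0 < Real.log 2 := Real.log_pos (by norm_num)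
  have hlogD : 0 ≤ Real.log (258 * D) := Real.log_nonneg (by linarith)
  refine ⟨256 * ((Real.log 2 + D * Real.log (258 * D)) / Real.log 2 + 2 * D * (1 + A₁ * D) + 1),
    by positivity, fun n Q ε ε' δ K m N hε hε1 hδ hδ1 hA₁ε hε'A hQ hK hm hKH hN => ?_⟩
  have hε' : 0 < ε' := (Real.rpow_pos_of_pos hε _).trans_le hA₁ε
  have hσ : 0 < ε' * ε := mul_pos hε' hε
  have hpow : ε ^ ((a + 1) * D) ≤ ε := by
    conv_rhs => rw [← Real.rpow_one ε]
    exact Real.rpow_le_rpow_of_exponent_ge hε (by linarith) (by nlinarith)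
  have hε'ε : ε' ≤ ε := (hε'A.trans (mul_le_of_le_one_left (by positivity) (min_le_left _ _))).trans
    hpow
  have hmass : Q.massIn Kᶜ ≤ ε / 2 := by
    calc Q.massIn Kᶜ ≤ m * ((D + 1) * ε') :=
          StochasticPoints.massIn_compl_le hε' hK hKH.2
      _ ≤ b * ε ^ (-(a * D)) * ((D + 1) * (1 / (2 * b * (D + 1)) * ε ^ ((a + 1) * D))) := by
          have := hε'A.trans (mul_le_mul_of_nonneg_right
            (min_le_right 1 (1 / (2 * b * ((D : ℝ) + 1)))) (by positivity))
          gcongr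
      _ = ε ^ (-(a * D) + (a + 1) * D) / 2 := by
          rw [Real.rpow_add hε]
          field_simp
      _ ≤ ε / 2 := by
          gcongr
          conv_rhs => rw [← Real.rpow_one ε]
          exact Real.rpow_le_rpow_of_exponent_ge hε (by linarith) (by nlinarith)
  -- If `K` were empty, all the mass, at least `ε`, would lie outside.
  have hKne : K.Nonempty := by
    by_contra hemp
    rw [Set.not_nonempty_iff_eq_empty] at hemp
    rw [Q.massIn_eq_totalProb (by simp [hemp])] at hmass
    linarith
  have hs : 1 ≤ ε ^ (-((a + 1) * D)) :=
    Real.one_le_rpow_of_pos_of_le_one_of_nonpos hε (by linarith) (by nlinarith)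
  have hNpos : 0 < N := by
    have h1 : 0 < Real.log (1 / ε) := Real.log_pos (by rw [lt_div_iff₀ hε]; linarith)
    have h2 : 0 < Real.log (1 / δ) := Real.log_pos (by rw [lt_div_iff₀ hδ]; linarith)
    have : (0 : ℝ) < N := lt_of_lt_of_le (by positivity) hN
    exact_mod_cast this
  have hq : 0 < ⌈256 * D / (ε' * ε) ^ 2⌉₊ := Nat.ceil_pos.2 (by positivity)
  have htail := two_mul_pow_mul_exp_le hD hε hε1 (by linarith) hδ hδ1 hA₁ε hs hN hA₁
  -- These values make `τ + 2η = ε' ε / 4`; with `√(2t) ≤ 2√t` the error is `ε · (ε' / 2) √t`,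
  -- matching `le_expectedMax`.
  have huniform := Q.le_sampleProb_uniform (Q.inside K) hNpos hq (τ := ε' * ε / 8)
    (η := ε' * ε / 16) (by positivity) (by nlinarith) (by positivity) (by
      rw [div_le_iff₀ (by exact_mod_cast hq)]
      have h1 := Nat.le_ceil (256 * (D : ℝ) / (ε' * ε) ^ 2)
      rw [div_le_iff₀ (by positivity)] at h1
      linarith)
  refine le_trans (by linarith) (huniform.trans (Q.sampleProb_mono fun S _ hS E hE u hu => ?_))
  obtain ⟨t, ht, htmass, htK⟩ := hKH.exists_level hε' (by linarith) hε hε1 hKne hu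
  refine Q.estimate_mem_Icc hε hε1 hE hu (Q.massIn_compl_eq K ▸ hmass) ?_
  have hdev := hS u (2 * t) (by positivity) fun i hi =>
    ⟨hu i, htK _ (StochasticPoints.mem_inside.1 hi)⟩
  have hX := Q.le_expectedMax hε'.le (by linarith) htmass
  have hsqrt : √(2 * t) ≤ 2 * √t := by
    rw [Real.sqrt_le_left (by positivity), mul_pow, Real.sq_sqrt ht]
    linarith
  calc _ ≤ (ε' * ε / 8 + 2 * (ε' * ε / 16)) * √(2 * t) := hdev
    _ ≤ (ε' * ε / 8 + 2 * (ε' * ε / 16)) * (2 * √t) := by gcongr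
    _ = ε * (ε' / 2 * √t) := by ring
    _ ≤ ε * Q.expectedMax u := by gcongr
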